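/- Let $(\Omega,\mathcal F,\mu)$ be a probability space and $T:\Omega\to\Omega$ an invertible bimeasurable measure-preserving map. For $m:\Omega\to\mathbb R$ put $S_k(m)=\sum_{j=0}^{k-1}m\circ T^j$ and, for $n\ge 1$ and $t\in[0,1]$, with $[\cdot]$ the integer part, $$S_n^{\mathrm{pl}}(m,t)=S_{[nt]}(m)+(nt-[nt])\,m\circ T^{[nt]}.$$ For $\alpha\in(0,1)$ and $x:[0,1]\to\mathbb R$ let $w_\alpha(x,\delta)=\sup_{0<|t-s|<\delta}|x(t)-x(s)|/|t-s|^\alpha$, let $\mathcal H_\alpha^o$ be the space of all $x$ with $\sup_{s\ne t}|x(t)-x(s)|/|t-s|^\alpha<\infty$ and $\lim_{\delta\to0}w_\alpha(x,\delta)=0$, and let $\|x\|_{\mathcal H_\alpha^o}=w_\alpha(x,1)+|x(0)|$. For a function $f$ on $\Omega$ let $\|f\|_{p,\infty}^p=\sup_{t>0}t^p\mu\{|f|>t\}\in[0,\infty]$. **Proposition 2.3.** Let $p>2$. There is a finite constant $C_p$ depending only on $p$ such that the following holds for all $(\Omega,\mathcal F,\mu,T)$ as above, every sub-$\sigma$-algebra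 $\mathcal M\subset\mathcal F$ with $T\mathcal M\subset\mathcal M$ (where $T\mathcal M=\{T(A):A\in\mathcal M\}$), and every integrable $\mathcal M$-measurable $m:\Omega\to\mathbb R$ with $\mathbb E[m\mid T\mathcal M]=0$ (that is, $(m\circ T^i)_i$ is a stationary martingale difference sequence for the filtration $(T^{-i}\mathcal M)_i$): the paths of $n^{-1/2}S_n^{\mathrm{pl}}(m)$ belong to $\mathcal H^o_{1/2-1/p}$ for all $n\ge1$, and $$\sup_{n\ge1}\Big\|\,\big\|n^{-1/2}S_n^{\mathrm{pl}}(m)\big\|_{\mathcal H^o_{1/2-1/p}}\Big\|_{p,\infty}^p\le C_p\Big(\|m\|_{p,\infty}^p+\mathbb E\big[(\mathbb E[m^2\mid T\mathcal M])^{p/2}\big]\Big),$$ where the right-hand side may be $+\infty$. -/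

import Mathlib

open MeasureTheory Filter Topology
open scoped ENNReal NNReal unitInterval

noncomputable section

namespace HolderWIP

/-- The modulus `w_α(x, δ) = sup_{0 < |t - s| < δ} |x t - x s| / |t - s| ^ α` of a function
`x : [0, 1] → ℝ`, with values in `[0, ∞]`. -/
def holderModulus (α : ℝ) (x : I → ℝ) (δ : ℝ) : ℝ≥0∞ :=
  ⨆ (s : I) (t : I) (_ : 0 < |(t : ℝ) - s| ∧ |(t : ℝ) - s| < δ),
    ENNReal.ofReal (|x t - x s| / |(t : ℝ) - s| ^ α)

/-- Membership in the Hölder space `H_α[0, 1]`. -/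
def MemHolderSpace (α : ℝ) (x : I → ℝ) : Prop :=
  (⨆ (s : I) (t : I) (_ : s ≠ t), ENNReal.ofReal (|x t - x s| / |(t : ℝ) - s| ^ α)) < ∞

/-- Membership in the separable Hölder space `H_α^o[0, 1]`. -/
def MemLittleHolder (α : ℝ) (x : I → ℝ) : Prop :=
  MemHolderSpace α x ∧ Tendsto (holderModulus α x) (𝓝[>] 0) (𝓝 0)

/-- The norm `‖x‖_α = w_α(x, 1) + |x(0)|` of `H_α^o[0, 1]`, written with values in `[0, ∞]`. -/
def holderNorm (α : ℝ) (x : I → ℝ) : ℝ≥0∞ :=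
  holderModulus α x 1 + ENNReal.ofReal |x 0|

/-- The Birkhoff sum `S_n(f) = ∑_{j=0}^{n-1} f ∘ T^j`. -/
def partialSum {Ω : Type*} (T : Ω → Ω) (f : Ω → ℝ) (n : ℕ) (ω : Ω) : ℝ :=
  ∑ j ∈ Finset.range n, f (T^[j] ω)

/-- The polygonal partial sum process
`S_n^pl(f, t) = S_[nt](f) + (nt - [nt]) f ∘ T^[nt]`, `t ∈ [0, 1]`: the continuous function of `t`,
affine on each `[k/n, (k+1)/n]`, with value `S_k(f)` at `k/n`. -/
def polygonalSum {Ω : Type*} (T : Ω → Ω) (f : Ω → ℝ) (n : ℕ) (ω : Ω) (t : I) : ℝ :=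
  partialSum T f ⌊(n : ℝ) * t⌋₊ ω
    + ((n : ℝ) * t - (⌊(n : ℝ) * t⌋₊ : ℝ)) * f (T^[⌊(n : ℝ) * t⌋₊] ω)

/-- The normalized process `n^{-1/2} S_n^pl(f)`. -/
def normalizedPolygonalSum {Ω : Type*} (T : Ω → Ω) (f : Ω → ℝ) (n : ℕ) (ω : Ω) (t : I) : ℝ :=
  (n : ℝ) ^ (-(1 / 2) : ℝ) * polygonalSum T f n ω t

/-- The `p`-th power of the weak-`L^p` quasinorm, `‖f‖_{p,∞}^p = sup_{t > 0} t^p μ{f > t}`,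
of a nonnegative function `f` (apply it to `|f|` for a real-valued `f`). -/
def weakNormPow {Ω : Type*} [MeasurableSpace Ω] (p : ℝ) (f : Ω → ℝ≥0∞) (μ : Measure Ω) : ℝ≥0∞ :=
  ⨆ (t : ℝ) (_ : 0 < t), ENNReal.ofReal (t ^ p) * μ {ω | ENNReal.ofReal t < f ω}

/-- The image σ-algebra `T M = {T(A) : A ∈ M}` under an invertible bimeasurable `T`:
the preimage of `M` under the inverse of `T`. -/
@[reducible] def imageSigma {Ω : Type*} (M : MeasurableSpace Ω) [MeasurableSpace Ω] (T : Ω ≃ᵐ Ω) :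
    MeasurableSpace Ω :=
  MeasurableSpace.comap (T.symm : Ω → Ω) M

/-- `(m ∘ T^i)` is a (strictly stationary) martingale difference sequence with respect to the
filtration `(T^{-i} M)`, for a measure-preserving `T`: `M` is a sub-σ-algebra with `T M ⊆ M`,
`m` is integrable and `M`-measurable, and `E[m | T M] = 0`. -/
structure IsStationaryMDS {Ω : Type*} (M : MeasurableSpace Ω) [mΩ : MeasurableSpace Ω]
    (μ : Measure Ω) (T : Ω ≃ᵐ Ω) (m : Ω → ℝ) : Prop where
  measurePreserving : MeasurePreserving T μ μ
  le : M ≤ mΩ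
  image_le : imageSigma M T ≤ M
  measurable : Measurable[M] m
  integrable : Integrable m μ
  condExp_eq_zero : μ[m | imageSigma M T] =ᵐ[μ] 0

/-- `E((E[m² | T M])^{p/2})`, with values in `[0, ∞]`. (Where `m²` is not integrable,
the weak-`L^p` quasinorm of `m` is infinite for `p > 2`.) -/
def condVarMoment {Ω : Type*} (M : MeasurableSpace Ω) [MeasurableSpace Ω] (p : ℝ)
    (μ : Measure Ω) (T : Ω ≃ᵐ Ω) (m : Ω → ℝ) : ℝ≥0∞ :=
  ∫⁻ ω, ENNReal.ofReal ((μ[fun ω' => m ω' ^ 2 | imageSigma M T]) ω) ^ (p / 2) ∂μ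

end HolderWIP

end

/-!
The proof rests on a good-λ inequality for the maximal function `S*_N = max_{k ≤ N} |S_k(m)|`
(`IsStationaryMDS.measure_exceedSet_two_mul_le`). Add up only the increments that arrive while the
running maximum lies in `(x, 2 x]` and the accumulated conditional variance is at most `(δ x)²`.
This is a predictable selection, so by orthogonality its second moment is at most
`(δ x)² μ(S*_N > x)`; on the other hand the selected sum is at least `(1 - δ) x` when `S*_N > 2 x`,
unless some increment exceeds `δ x` or the conditional variance exceeds `(δ x)²`. Hence
`μ(S*_N > 2 x) ≤ (δ / (1 - δ))² μ(S*_N > x) + N μ(|m| > δ x) + μ(V_N > (δ x)²)`,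
where `V_N` is the Birkhoff sum of the conditional variance.

With `α = 1/2 - 1/p`, the inequality is used at all dyadic scales simultaneously, through the series
`F x = ∑ i, 2^{-i} μ(S*_{2^i} > x 2^{iα})` (`tailSeries`). The increment terms sum to a multiple of
`x^{-p} ‖m‖_{p,∞}^p`, a geometric series since `α > 0`. The variance terms are tails of ergodic
averages at the levels `x² 2^{-2i/p}`, up to a constant; cutting the conditional variance at half
the level and applying Markov's inequality to the upper part reduces their sum to a pointwise
geometric series, bounded by `x^{-p} E[(E[m² | T M])^{p/2}]`. So `F (2 x) ≤ ε F x + K x^{-p}` with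
`ε 2^{p+1} ≤ 1` for small `δ`; since `F` is bounded, iteration gives `F x ≤ 2^{p+1} K x^{-p}`.

For the Hölder norm, two times at distance between `2^{i-1}` and `2^i` (in steps) lie in the same or
in adjacent dyadic blocks of length `2^i`, so the norm exceeds `t` only if on one of the at most
`3 n 2^{-i}` blocks of some length `2^i ≤ 2 n` the partial sums oscillate by more than a multiple of
`t n^{1/p} 2^{iα}`; for times less than one step apart the path is Lipschitz and blocks of length `1`
suffice. By stationarity the probability of this is at most `3 n F (t n^{1/p} / 6)`, and
the factor `n` cancels. Finally, a finite weak norm with `p > 2` puts `m` in `L²`, where the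
orthogonality argument takes place.
-/

namespace HolderWIP

/-! ### Pathwise inequalities for partial sums -/

/-- If the steps `X i` are bounded by `δ x`, then the sum of those steps taken while the running
maximum of `|S|` lies in `(x, 2 x]` is at least `(1 - δ) x` in absolute value once `|S|` has
exceeded `2 x`. -/
theorem le_abs_sum_between_levels (X : ℕ → ℝ) {x δ : ℝ} (hx : 0 < x) (hδ : δ ≤ 1) (n : ℕ)
    (hX : ∀ i < n, |X i| ≤ δ * x) (g : ℕ → ℝ)
    (hg : ∀ i < n, (∃ k ≤ i, x < |∑ j ∈ Finset.range k, X j|) →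
      (∀ k ≤ i, |∑ j ∈ Finset.range k, X j| ≤ 2 * x) → g i = X i)
    (hg1 : ∀ i < n, (∀ k ≤ i, |∑ j ∈ Finset.range k, X j| ≤ x) → g i = 0)
    (hg2 : ∀ i < n, (∃ k ≤ i, 2 * x < |∑ j ∈ Finset.range k, X j|) → g i = 0)
    (h : ∃ k ≤ n, 2 * x < |∑ j ∈ Finset.range k, X j|) :
    (1 - δ) * x ≤ |∑ i ∈ Finset.range n, g i| := by
  -- the three phases of the running maximum: below `x`, between the levels, above `2 x`
  have key : ∀ l ≤ n,
      ((∀ k ≤ l, |∑ j ∈ Finset.range k, X j| ≤ x) → ∑ i ∈ Finset.range l, g i = 0) ∧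
      ((∃ k ≤ l, x < |∑ j ∈ Finset.range k, X j|) →
        (∀ k ≤ l, |∑ j ∈ Finset.range k, X j| ≤ 2 * x) →
        |∑ i ∈ Finset.range l, g i - ∑ i ∈ Finset.range l, X i| ≤ (1 + δ) * x) ∧
      ((∃ k ≤ l, 2 * x < |∑ j ∈ Finset.range k, X j|) →
        (1 - δ) * x ≤ |∑ i ∈ Finset.range l, g i|) := by
    intro l
    induction l with
    | zero =>
      intro _
      refine ⟨fun _ => by simp, fun ⟨k, hk, hk'⟩ => ?_, fun ⟨k, hk, hk'⟩ => ?_⟩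
      all_goals
        obtain rfl : k = 0 := by omega
        simp at hk'
        linarith
    | succ l ih =>
      intro hl
      obtain ⟨ih0, ih1, ih2⟩ := ih (by omega)
      have hXl := hX l (by omega)
      have hgl := hg l (by omega)
      have hgl1 := hg1 l (by omega)
      have hgl2 := hg2 l (by omega)
      have hs : ∀ f : ℕ → ℝ, ∑ i ∈ Finset.range (l + 1), f i
          = ∑ i ∈ Finset.range l, f i + f l := fun f => Finset.sum_range_succ f l
      by_cases hA : ∃ k ≤ l, 2 * x < |∑ j ∈ Finset.range k, X j|
      · obtain ⟨k, hk, hk'⟩ := hA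
        refine ⟨fun h' => ?_, fun _ h' => ?_, fun _ => ?_⟩
        · have := h' k (by omega)
          linarith
        · have := h' k (by omega)
          linarith
        · rw [hs, hgl2 ⟨k, hk, hk'⟩, add_zero]
          exact ih2 ⟨k, hk, hk'⟩
      push Not at hA
      by_cases hB : ∃ k ≤ l, x < |∑ j ∈ Finset.range k, X j|
      · have h1 := ih1 hB hA
        have hgX := hgl hB hA
        refine ⟨fun h' => ?_, fun _ _ => ?_, fun ⟨k, hk, hk'⟩ => ?_⟩
        · obtain ⟨k, hk, hk'⟩ := hB
          have := h' k (by omega)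
          linarith
        · rw [hs, hs, hgX]
          convert h1 using 2
          ring
        · have hkl : k = l + 1 := by
            by_contra hne
            have := hA k (by omega)
            linarith
          subst hkl
          have e : ∑ i ∈ Finset.range (l + 1), X i = ∑ i ∈ Finset.range (l + 1), g i
              - (∑ i ∈ Finset.range l, g i - ∑ i ∈ Finset.range l, X i) := by
            rw [hs, hs, hgX]
            ring
          rw [e] at hk'
          have := abs_sub (∑ i ∈ Finset.range (l + 1), g i)
            (∑ i ∈ Finset.range l, g i - ∑ i ∈ Finset.range l, X i)
          linarith
      · push Not at hB
        have h0 : ∑ i ∈ Finset.range (l + 1), g i = 0 := by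
          rw [hs, ih0 hB, hgl1 hB, add_zero]
        have hS : |∑ i ∈ Finset.range (l + 1), X i| ≤ (1 + δ) * x := by
          rw [hs]
          have := abs_add_le (∑ i ∈ Finset.range l, X i) (X l)
          have := hB l le_rfl
          linarith
        refine ⟨fun _ => h0, fun _ _ => by rw [h0, zero_sub, abs_neg]; exact hS,
          fun ⟨k, hk, hk'⟩ => ?_⟩
        rcases Nat.lt_or_ge k (l + 1) with hkl | hkl
        · have := hB k (by omega)
          linarith
        · obtain rfl : k = l + 1 := by omega
          nlinarith
  exact (key n le_rfl).2.2 h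

/-- The terms of a series that are added only while the partial sums stay below `c` add up to at
most `c`. -/
theorem sum_le_of_partial_sums_le (w g : ℕ → ℝ) {c : ℝ} (hc : 0 ≤ c)
    (hg : ∀ i, g i ≤ w i)
    (hg0 : ∀ i, c < ∑ k ∈ Finset.range (i + 1), w k → g i ≤ 0) (n : ℕ) :
    ∑ i ∈ Finset.range n, g i ≤ c := by
  induction n with
  | zero => simpa
  | succ n ih =>
    rcases lt_or_ge c (∑ k ∈ Finset.range (n + 1), w k) with h | h
    · rw [Finset.sum_range_succ]
      linarith [hg0 n h]
    · exact (Finset.sum_le_sum fun i _ => hg i).trans h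

/-! ### Polygonal lines -/

/-- The polygonal line on `[0, ∞)` with value `∑ j < k, X j` at each natural number `k`. -/
noncomputable def polyline (X : ℕ → ℝ) (u : ℝ) : ℝ :=
  ∑ j ∈ Finset.range ⌊u⌋₊, X j + (u - (⌊u⌋₊ : ℝ)) * X ⌊u⌋₊

theorem abs_polyline_sub_le_of_abs_le (X : ℕ → ℝ) {n : ℕ} {K u v : ℝ}
    (hX : ∀ k ≤ n, |X k| ≤ K) (hu : 0 ≤ u) (huv : u ≤ v) (hv : v ≤ n) :
    |polyline X v - polyline X u| ≤ K * (v - u) := by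
  have hab : ⌊u⌋₊ ≤ ⌊v⌋₊ := Nat.floor_mono huv
  have hbn : ⌊v⌋₊ ≤ n := Nat.floor_le_of_le hv
  have hua := Nat.floor_le hu
  have hua' := Nat.lt_floor_add_one u
  have hvb := Nat.floor_le (hu.trans huv)
  unfold polyline
  set a := ⌊u⌋₊
  set b := ⌊v⌋₊
  have mulb : ∀ k ≤ n, ∀ c : ℝ, 0 ≤ c → |c * X k| ≤ K * c := fun k hk c hc => by
    rw [abs_mul, abs_of_nonneg hc, mul_comm]
    exact mul_le_mul_of_nonneg_right (hX k hk) hc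
  rcases hab.eq_or_lt with h | h
  · have := mulb b hbn (v - u) (by linarith)
    rw [h]
    convert this using 2
    ring
  · have hsum : ∑ j ∈ Finset.range b, X j = ∑ j ∈ Finset.range (a + 1), X j
        + ∑ j ∈ Finset.Ico (a + 1) b, X j := by
      rw [Finset.sum_range_add_sum_Ico _ (by omega)]
    have hIco : |∑ j ∈ Finset.Ico (a + 1) b, X j| ≤ K * ((b : ℝ) - (a + 1)) := by
      refine (Finset.abs_sum_le_sum_abs _ _).trans ?_
      refine (Finset.sum_le_card_nsmul _ _ K fun j hj => hX j ?_).trans ?_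
      · have := (Finset.mem_Ico.mp hj).2
        omega
      · rw [Nat.card_Ico, nsmul_eq_mul, Nat.cast_sub (by omega)]
        push_cast
        linarith
    have h1 := mulb a (by omega) (a + 1 - u) (by linarith)
    have h2 := mulb b hbn (v - b) (by linarith)
    have e : ∑ j ∈ Finset.range b, X j + (v - b) * X b
        - (∑ j ∈ Finset.range a, X j + (u - a) * X a)
        = (a + 1 - u) * X a + ∑ j ∈ Finset.Ico (a + 1) b, X j + (v - b) * X b := by
      rw [hsum, Finset.sum_range_succ]
      ring
    rw [e]
    have := abs_add_le ((a + 1 - u) * X a + ∑ j ∈ Finset.Ico (a + 1) b, X j) ((v - b) * X b)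
    have := abs_add_le ((a + 1 - u) * X a) (∑ j ∈ Finset.Ico (a + 1) b, X j)
    linarith

/-- Within a block, the polygonal line stays as close to its initial value as the partial sums. -/
theorem abs_polyline_sub_le_of_block (X : ℕ → ℝ) {l a : ℕ} {y u : ℝ}
    (hy : ∀ r ≤ l, |∑ j ∈ Finset.range (a * l + r), X j - ∑ j ∈ Finset.range (a * l), X j| ≤ y)
    (hu : ((a * l : ℕ) : ℝ) ≤ u) (hu' : u < ((a * l + l : ℕ) : ℝ)) :
    |polyline X u - ∑ j ∈ Finset.range (a * l), X j| ≤ y := by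
  have hu0 : 0 ≤ u := le_trans (by positivity) hu
  have h1 : a * l ≤ ⌊u⌋₊ := Nat.le_floor hu
  have h2 : ⌊u⌋₊ < a * l + l := (Nat.floor_lt hu0).mpr hu'
  have hfl := Nat.floor_le hu0
  have hfl' := Nat.lt_floor_add_one u
  unfold polyline
  set k := ⌊u⌋₊
  have e1 := hy (k - a * l) (by omega)
  have e2 := hy (k + 1 - a * l) (by omega)
  rw [Nat.add_sub_cancel' h1] at e1
  rw [Nat.add_sub_cancel' (by omega), Finset.sum_range_succ] at e2
  set s := ∑ j ∈ Finset.range k, X j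
  set s0 := ∑ j ∈ Finset.range (a * l), X j
  rw [abs_le] at *
  constructor <;> nlinarith

/-- Two points at distance at most `l` lie in the same or in adjacent blocks of length `l`. -/
theorem abs_polyline_sub_le_of_blocks (X : ℕ → ℝ) {l n : ℕ} (hl : 0 < l) {y u v : ℝ}
    (hy : ∀ a, a * l ≤ n → ∀ r ≤ l,
      |∑ j ∈ Finset.range (a * l + r), X j - ∑ j ∈ Finset.range (a * l), X j| ≤ y)
    (hu : 0 ≤ u) (huv : u ≤ v) (hv : v ≤ n) (hl' : v - u ≤ l) :
    |polyline X v - polyline X u| ≤ 3 * y := by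
  have hlR : (0 : ℝ) < l := by exact_mod_cast hl
  have block : ∀ z : ℝ, 0 ≤ z → z ≤ n → ((⌊z / l⌋₊ * l : ℕ) : ℝ) ≤ z ∧
      z < ((⌊z / l⌋₊ * l + l : ℕ) : ℝ) ∧ ⌊z / l⌋₊ * l ≤ n := by
    intro z hz hzn
    have h1 := Nat.floor_le (div_nonneg hz hlR.le)
    have h2 := Nat.lt_floor_add_one (z / l)
    rw [le_div_iff₀ hlR] at h1
    rw [div_lt_iff₀ hlR] at h2
    refine ⟨by push_cast; exact h1, by push_cast; linarith, ?_⟩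
    exact_mod_cast h1.trans hzn
  obtain ⟨u1, u2, u3⟩ := block u hu (huv.trans hv)
  obtain ⟨v1, v2, v3⟩ := block v (hu.trans huv) hv
  have hab : ⌊u / l⌋₊ ≤ ⌊v / l⌋₊ := Nat.floor_mono (by gcongr)
  have hba : ⌊v / l⌋₊ ≤ ⌊u / l⌋₊ + 1 := by
    have : v / l ≤ u / l + 1 := by
      rw [div_add_one hlR.ne', div_le_div_iff_of_pos_right hlR]
      linarith
    calc ⌊v / l⌋₊ ≤ ⌊u / l + 1⌋₊ := Nat.floor_mono this
      _ = ⌊u / l⌋₊ + 1 := Nat.floor_add_one (div_nonneg hu hlR.le)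
  set a := ⌊u / l⌋₊
  set b := ⌊v / l⌋₊
  have hU := abs_polyline_sub_le_of_block X (hy a u3) u1 u2
  have hV := abs_polyline_sub_le_of_block X (hy b v3) v1 v2
  have hW : |∑ j ∈ Finset.range (b * l), X j - ∑ j ∈ Finset.range (a * l), X j| ≤ y := by
    have : b = a ∨ b = a + 1 := by omega
    rcases this with h | h
    · simpa [h] using hy a u3 0 (by omega)
    · have := hy a u3 l le_rfl
      rwa [h, add_one_mul]
  rw [abs_le] at *
  constructor <;> linarith

/-- Oscillation bounds on the dyadic blocks at all scales give a Hölder bound. -/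
theorem abs_polyline_sub_le_rpow (X : ℕ → ℝ) {n : ℕ} (hn : 1 ≤ n) {α D u v : ℝ} (hα0 : 0 ≤ α)
    (hα1 : α ≤ 1)
    (hD : ∀ i, 2 ^ i ≤ 2 * n → ∀ a, a * 2 ^ i ≤ n → ∀ r ≤ 2 ^ i,
      |∑ j ∈ Finset.range (a * 2 ^ i + r), X j - ∑ j ∈ Finset.range (a * 2 ^ i), X j|
        ≤ D * ((2 : ℝ) ^ i) ^ α)
    (hu : 0 ≤ u) (huv : u ≤ v) (hv : v ≤ n) :
    |polyline X v - polyline X u| ≤ 6 * D * (v - u) ^ α := by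
  have hD0 : 0 ≤ D := by
    have := hD 0 (by simp; omega) 0 (by simp) 0 (by simp)
    simpa using this
  have hvu : 0 ≤ v - u := sub_nonneg.mpr huv
  rcases le_or_gt 1 (v - u) with h | h
  · obtain ⟨i, hi1, hi2⟩ := exists_nat_pow_near h (one_lt_two (α := ℝ))
    have hin : 2 ^ (i + 1) ≤ 2 * n := by
      have : (2 : ℝ) ^ (i + 1) ≤ 2 * n := by
        rw [pow_succ]
        linarith
      exact_mod_cast this
    have h1 := abs_polyline_sub_le_of_blocks X (l := 2 ^ (i + 1)) (by positivity)
      (hD (i + 1) hin) hu huv hv (by push_cast; exact hi2.le)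
    have h2 : ((2 : ℝ) ^ (i + 1)) ^ α ≤ 2 * (v - u) ^ α :=
      calc ((2 : ℝ) ^ (i + 1)) ^ α ≤ (2 * (v - u)) ^ α := by
            refine Real.rpow_le_rpow (by positivity) ?_ hα0
            rw [pow_succ]
            linarith
        _ = 2 ^ α * (v - u) ^ α := Real.mul_rpow zero_le_two hvu
        _ ≤ 2 * (v - u) ^ α := by
            gcongr
            calc (2 : ℝ) ^ α ≤ 2 ^ (1 : ℝ) := Real.rpow_le_rpow_of_exponent_le one_le_two hα1
              _ = 2 := Real.rpow_one 2
    nlinarith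
  · have h1 : |polyline X v - polyline X u| ≤ D * (v - u) := by
      refine abs_polyline_sub_le_of_abs_le X (n := n) (fun k hk => ?_) hu huv hv
      have := hD 0 (by simp; omega) k (by simpa using hk) 1 (by simp)
      simpa [Finset.sum_range_succ] using this
    have h2 : v - u ≤ (v - u) ^ α := Real.self_le_rpow_of_le_one hvu h.le hα1
    have h3 : 0 ≤ (v - u) ^ α := Real.rpow_nonneg hvu α
    nlinarith [mul_le_mul_of_nonneg_left h2 hD0, mul_nonneg hD0 h3]

/-! ### Hölder norms of the partial sum paths -/

theorem memLittleHolder_of_lipschitz {α K : ℝ} (hα : α < 1) {x : I → ℝ}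
    (hx : ∀ s t : I, |x t - x s| ≤ K * |(t : ℝ) - s|) : MemLittleHolder α x := by
  have hK : 0 ≤ K := by
    have := (abs_nonneg _).trans (hx 0 1)
    simpa using this
  have bound : ∀ s t : I, 0 < |(t : ℝ) - s| →
      |x t - x s| / |(t : ℝ) - s| ^ α ≤ K * |(t : ℝ) - s| ^ (1 - α) := by
    intro s t h
    rw [div_le_iff₀ (Real.rpow_pos_of_pos h α), mul_assoc, ← Real.rpow_add h]
    simpa using hx s t
  have hα' : 0 ≤ 1 - α := by linarith
  constructor
  · refine lt_of_le_of_lt (b := ENNReal.ofReal K) ?_ ENNReal.ofReal_lt_top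
    refine iSup_le fun s => iSup_le fun t => iSup_le fun hst => ENNReal.ofReal_le_ofReal ?_
    have h0 : 0 < |(t : ℝ) - s| :=
      abs_pos.mpr (sub_ne_zero.mpr fun h => hst (Subtype.ext h.symm))
    have h1 : |(t : ℝ) - s| ≤ 1 := by
      rw [abs_le]
      constructor <;> linarith [t.2.1, t.2.2, s.2.1, s.2.2]
    refine (bound s t h0).trans ?_
    exact mul_le_of_le_one_right hK (Real.rpow_le_one h0.le h1 hα')
  · have hlim : Tendsto (fun δ : ℝ => ENNReal.ofReal (K * δ ^ (1 - α))) (𝓝[>] 0) (𝓝 0) := by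
      have : Tendsto (fun δ : ℝ => ENNReal.ofReal (K * δ ^ (1 - α))) (𝓝 0)
          (𝓝 (ENNReal.ofReal (K * 0 ^ (1 - α)))) :=
        ENNReal.tendsto_ofReal
          ((Real.continuousAt_rpow_const 0 (1 - α) (Or.inr hα')).tendsto.const_mul K)
      rw [Real.zero_rpow (by linarith), mul_zero, ENNReal.ofReal_zero] at this
      exact this.mono_left nhdsWithin_le_nhds
    refine tendsto_of_tendsto_of_tendsto_of_le_of_le tendsto_const_nhds hlim (fun _ => zero_le)
      fun δ => ?_
    refine iSup_le fun s => iSup_le fun t => iSup_le fun hst => ENNReal.ofReal_le_ofReal ?_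
    refine (bound s t hst.1).trans ?_
    exact mul_le_mul_of_nonneg_left (Real.rpow_le_rpow hst.1.le hst.2.le hα') hK

theorem normalizedPolygonalSum_eq_polyline {Ω : Type*} (T : Ω → Ω) (f : Ω → ℝ) (n : ℕ) (ω : Ω)
    (t : I) : normalizedPolygonalSum T f n ω t
      = (n : ℝ) ^ (-(1 / 2) : ℝ) * polyline (fun j => f (T^[j] ω)) (n * t) := rfl

theorem memLittleHolder_normalizedPolygonalSum {Ω : Type*} (T : Ω → Ω) (f : Ω → ℝ) (n : ℕ) (ω : Ω)
    {α : ℝ} (hα : α < 1) : MemLittleHolder α (normalizedPolygonalSum T f n ω) := by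
  have hX : ∀ k ≤ n, |f (T^[k] ω)| ≤ ∑ j ∈ Finset.range (n + 1), |f (T^[j] ω)| := fun k hk =>
    Finset.single_le_sum (f := fun j => |f (T^[j] ω)|) (fun j _ => abs_nonneg _)
      (Finset.mem_range.mpr (by omega))
  set K := ∑ j ∈ Finset.range (n + 1), |f (T^[j] ω)|
  refine memLittleHolder_of_lipschitz (K := (n : ℝ) ^ (-(1 / 2) : ℝ) * (K * n)) hα fun s t => ?_
  have hn : (0 : ℝ) ≤ n := n.cast_nonneg
  wlog hst : (s : ℝ) ≤ t generalizing s t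
  · have := this t s (le_of_not_ge hst)
    rwa [abs_sub_comm, abs_sub_comm (t : ℝ)]
  have h := abs_polyline_sub_le_of_abs_le (fun j => f (T^[j] ω)) hX (mul_nonneg hn s.2.1)
    (mul_le_mul_of_nonneg_left hst hn) (mul_le_of_le_one_right hn t.2.2)
  simp only [normalizedPolygonalSum_eq_polyline]
  rw [← mul_sub, abs_mul, abs_of_nonneg (Real.rpow_nonneg hn _), mul_assoc,
    abs_of_nonneg (sub_nonneg.mpr hst)]
  refine mul_le_mul_of_nonneg_left ?_ (Real.rpow_nonneg hn _)
  linarith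

theorem partialSum_add {Ω : Type*} (T : Ω → Ω) (f : Ω → ℝ) (a r : ℕ) (ω : Ω) :
    partialSum T f (a + r) ω - partialSum T f a ω = partialSum T f r (T^[a] ω) := by
  unfold partialSum
  rw [Finset.sum_range_add, add_sub_cancel_left]
  simp only [← Function.iterate_add_apply, add_comm]

/-- A large Hölder norm of the path forces a large oscillation of the partial sums over some
dyadic block. -/
theorem holderNorm_normalizedPolygonalSum_le {Ω : Type*} (T : Ω → Ω) (f : Ω → ℝ) {n : ℕ}
    (hn : 1 ≤ n) (ω : Ω) {α D : ℝ} (hα0 : 0 ≤ α) (hα1 : α ≤ 1)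
    (hD : ∀ i, 2 ^ i ≤ 2 * n → ∀ a, a * 2 ^ i ≤ n → ∀ r ≤ 2 ^ i,
      |partialSum T f r (T^[a * 2 ^ i] ω)| ≤ D * ((2 : ℝ) ^ i) ^ α) :
    holderNorm α (normalizedPolygonalSum T f n ω)
      ≤ ENNReal.ofReal (6 * D * (n : ℝ) ^ (α - 1 / 2)) := by
  have hn0 : (0 : ℝ) < n := by exact_mod_cast hn
  simp only [← partialSum_add] at hD
  have h0 : normalizedPolygonalSum T f n ω 0 = 0 := by
    simp [normalizedPolygonalSum, polygonalSum, partialSum]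
  rw [holderNorm, h0, abs_zero, ENNReal.ofReal_zero, add_zero]
  refine iSup_le fun s => iSup_le fun t => iSup_le fun hst => ENNReal.ofReal_le_ofReal ?_
  obtain ⟨hst, -⟩ := hst
  rw [div_le_iff₀ (Real.rpow_pos_of_pos hst α)]
  clear hst
  wlog hst : (s : ℝ) ≤ t generalizing s t
  · have := this t s (le_of_not_ge hst)
    rwa [abs_sub_comm, abs_sub_comm (t : ℝ)]
  have h := abs_polyline_sub_le_rpow (fun j => f (T^[j] ω)) hn hα0 hα1 hD
    (mul_nonneg hn0.le s.2.1) (mul_le_mul_of_nonneg_left hst hn0.le)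
    (mul_le_of_le_one_right hn0.le t.2.2)
  have hts : 0 ≤ (t : ℝ) - s := sub_nonneg.mpr hst
  rw [← mul_sub, Real.mul_rpow hn0.le hts] at h
  simp only [normalizedPolygonalSum_eq_polyline]
  rw [← mul_sub, abs_mul, abs_of_nonneg (Real.rpow_nonneg hn0.le _), abs_of_nonneg hts]
  refine (mul_le_mul_of_nonneg_left h (Real.rpow_nonneg hn0.le _)).trans_eq ?_
  rw [sub_eq_neg_add α, Real.rpow_add hn0]
  ring

/-! ### The martingale transform -/

/-- The σ-algebra `T^{-i} (T M)` of the events that are known before the `i`-th increment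
`m ∘ T^i` is observed. -/
@[reducible] def pastSigma {Ω : Type*} (M : MeasurableSpace Ω) [MeasurableSpace Ω] (T : Ω ≃ᵐ Ω)
    (i : ℕ) : MeasurableSpace Ω :=
  MeasurableSpace.comap (T^[i]) (imageSigma M T)

/-- The nonnegative version of the conditional variance `E[m² | T M]`. -/
noncomputable def condVar {Ω : Type*} (M : MeasurableSpace Ω) [MeasurableSpace Ω] (μ : Measure Ω)
    (T : Ω ≃ᵐ Ω) (m : Ω → ℝ) (ω : Ω) : ℝ :=
  max ((μ[fun ω' => m ω' ^ 2 | imageSigma M T]) ω) 0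

/-- The event that `|S_k(m)|` exceeds `x` for some `k ≤ n`. -/
def exceedSet {Ω : Type*} [MeasurableSpace Ω] (T : Ω ≃ᵐ Ω) (m : Ω → ℝ) (n : ℕ) (x : ℝ) : Set Ω :=
  {ω | ∃ k ≤ n, x < |partialSum T m k ω|}

/-- The `i`-th increment is selected on this event: the running maximum of `|S|` lies in
`(x, 2 x]` and the conditional variance accumulated up to and including time `i` is at
most `c`. -/
def selectSet {Ω : Type*} (M : MeasurableSpace Ω) [MeasurableSpace Ω] (μ : Measure Ω)
    (T : Ω ≃ᵐ Ω) (m : Ω → ℝ) (x c : ℝ) (i : ℕ) : Set Ω :=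
  (exceedSet T m i x \ exceedSet T m i (2 * x)) ∩ {ω | partialSum T (condVar M μ T m) (i + 1) ω ≤ c}

section Martingale

variable {Ω : Type*} {M : MeasurableSpace Ω} [mΩ : MeasurableSpace Ω] {μ : Measure Ω}
  {T : Ω ≃ᵐ Ω} {m : Ω → ℝ}

theorem pastSigma_succ (i : ℕ) : pastSigma M T (i + 1) = MeasurableSpace.comap (T^[i]) M := by
  rw [pastSigma, imageSigma, MeasurableSpace.comap_comp, Function.iterate_succ',
    ← Function.comp_assoc, T.symm_comp_self, Function.id_comp]

theorem IsStationaryMDS.pastSigma_mono (h : IsStationaryMDS M μ T m) : Monotone (pastSigma M T) :=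
  monotone_nat_of_le_succ fun i => by
    rw [pastSigma_succ]
    exact MeasurableSpace.comap_mono h.image_le

theorem IsStationaryMDS.pastSigma_le (h : IsStationaryMDS M μ T m) (i : ℕ) :
    pastSigma M T i ≤ mΩ :=
  (MeasurableSpace.comap_mono (h.image_le.trans h.le)).trans
    (h.measurePreserving.iterate i).measurable.comap_le

theorem IsStationaryMDS.measurable_iterate (h : IsStationaryMDS M μ T m) {i k : ℕ} (hik : i < k) :
    Measurable[pastSigma M T k] fun ω => m (T^[i] ω) := by
  refine Measurable.mono ?_ (h.pastSigma_mono (Nat.succ_le_of_lt hik)) le_rfl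
  rw [pastSigma_succ]
  exact h.measurable.comp (comap_measurable _)

theorem IsStationaryMDS.measurable_partialSum (h : IsStationaryMDS M μ T m) {i k : ℕ}
    (hik : i ≤ k) : Measurable[pastSigma M T k] (partialSum T m i) :=
  Finset.measurable_sum _ fun _ hj =>
    h.measurable_iterate ((Finset.mem_range.mp hj).trans_le hik)

theorem measurable_condVar : Measurable[imageSigma M T] (condVar M μ T m) :=
  stronglyMeasurable_condExp.measurable.max measurable_const

theorem IsStationaryMDS.measurable_partialSum_condVar (h : IsStationaryMDS M μ T m) (i : ℕ) :
    Measurable[pastSigma M T i] (partialSum T (condVar M μ T m) (i + 1)) :=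
  Finset.measurable_sum _ fun j hj => by
    have hji : j ≤ i := Nat.lt_succ_iff.mp (Finset.mem_range.mp hj)
    refine Measurable.mono ?_ (h.pastSigma_mono hji) le_rfl
    exact measurable_condVar.comp (comap_measurable _)

theorem IsStationaryMDS.integral_mul_iterate_eq_zero [IsProbabilityMeasure μ]
    (h : IsStationaryMDS M μ T m) (hm : MemLp m 2 μ) {i : ℕ} {g : Ω → ℝ}
    (hg : Measurable[pastSigma M T i] g) (hg2 : MemLp g 2 μ) :
    ∫ ω, g ω * m (T^[i] ω) ∂μ = 0 := by
  have hle : imageSigma M T ≤ mΩ := h.image_le.trans h.le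
  obtain ⟨Z, hZ, rfl⟩ := Measurable.exists_eq_measurable_comp (mY := imageSigma M T) hg
  have hTi := h.measurePreserving.iterate i
  have hZ' : Measurable Z := hZ.mono hle le_rfl
  have hm' : Measurable m := h.measurable.mono h.le le_rfl
  have hZ2 : MemLp Z 2 μ := by
    rw [← hTi.map_eq]
    exact (memLp_map_measure_iff hZ'.aestronglyMeasurable hTi.aemeasurable).mpr hg2
  have e : ∫ ω, (Z ∘ T^[i]) ω * m (T^[i] ω) ∂μ = ∫ ω, (Z * m) ω ∂μ := by
    conv_rhs => rw [← hTi.map_eq]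
    rw [integral_map hTi.aemeasurable (hZ'.mul hm').aestronglyMeasurable]
    rfl
  rw [e, ← integral_condExp hle]
  refine integral_eq_zero_of_ae ?_
  filter_upwards [condExp_mul_of_stronglyMeasurable_left hZ.stronglyMeasurable
    (hZ2.integrable_mul hm) h.integrable, h.condExp_eq_zero] with ω h1 h2
  rw [h1, Pi.mul_apply, h2]
  simp

theorem IsStationaryMDS.setIntegral_sq_iterate [IsProbabilityMeasure μ]
    (h : IsStationaryMDS M μ T m) (hm : MemLp m 2 μ) {i : ℕ} {A : Set Ω}
    (hA : MeasurableSet[pastSigma M T i] A) :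
    ∫ ω in A, m (T^[i] ω) ^ 2 ∂μ
      = ∫ ω in A, (μ[fun ω' => m ω' ^ 2 | imageSigma M T]) (T^[i] ω) ∂μ := by
  have hle : imageSigma M T ≤ mΩ := h.image_le.trans h.le
  obtain ⟨B, hB, rfl⟩ := hA
  have hTi := h.measurePreserving.iterate i
  have hB' : MeasurableSet B := hle _ hB
  have pull : ∀ f : Ω → ℝ, AEStronglyMeasurable f μ →
      ∫ ω in T^[i] ⁻¹' B, f (T^[i] ω) ∂μ = ∫ ω in B, f ω ∂μ := fun f hf => by
    conv_rhs => rw [← hTi.map_eq]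
    rw [setIntegral_map hB' (by rwa [hTi.map_eq]) hTi.aemeasurable]
  rw [pull _ (hm.integrable_sq).aestronglyMeasurable, pull _ integrable_condExp.aestronglyMeasurable,
    setIntegral_condExp hle hm.integrable_sq hB]

theorem IsStationaryMDS.memLp_iterate (h : IsStationaryMDS M μ T m) (hm : MemLp m 2 μ) (i : ℕ) :
    MemLp (fun ω => m (T^[i] ω)) 2 μ :=
  hm.comp_measurePreserving (h.measurePreserving.iterate i)

theorem IsStationaryMDS.memLp_transform (h : IsStationaryMDS M μ T m) (hm : MemLp m 2 μ)
    {A : ℕ → Set Ω} (hA : ∀ i, MeasurableSet[pastSigma M T i] (A i)) (n : ℕ) :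
    MemLp (fun ω => ∑ i ∈ Finset.range n, (A i).indicator (fun ω => m (T^[i] ω)) ω) 2 μ :=
  memLp_finsetSum _ fun i _ => (h.memLp_iterate hm i).indicator (h.pastSigma_le i _ (hA i))

/-- Orthogonality of the increments: the second moment of a predictable selection of the
increments is the integral of the selected conditional variances. -/
theorem IsStationaryMDS.integral_transform_sq [IsProbabilityMeasure μ]
    (h : IsStationaryMDS M μ T m) (hm : MemLp m 2 μ) {A : ℕ → Set Ω}
    (hA : ∀ i, MeasurableSet[pastSigma M T i] (A i)) (n : ℕ) :
    ∫ ω, (∑ i ∈ Finset.range n, (A i).indicator (fun ω => m (T^[i] ω)) ω) ^ 2 ∂μ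
      = ∫ ω, ∑ i ∈ Finset.range n, (A i).indicator
          (fun ω => (μ[fun ω' => m ω' ^ 2 | imageSigma M T]) (T^[i] ω)) ω ∂μ := by
  have hA' : ∀ i, MeasurableSet (A i) := fun i => h.pastSigma_le i _ (hA i)
  have hv : ∀ i, Integrable (fun ω => (μ[fun ω' => m ω' ^ 2 | imageSigma M T]) (T^[i] ω)) μ :=
    fun i => (h.measurePreserving.iterate i).integrable_comp_of_integrable integrable_condExp
  rw [integral_finsetSum _ fun i _ => (hv i).indicator (hA' i)]
  induction n with
  | zero => simp
  | succ n ih =>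
    set Y : Ω → ℝ := fun ω => ∑ i ∈ Finset.range n, (A i).indicator (fun ω => m (T^[i] ω)) ω
    have hY : MemLp Y 2 μ := h.memLp_transform hm hA n
    have hYm : Measurable[pastSigma M T n] Y := Finset.measurable_sum _ fun i hi =>
      (h.measurable_iterate (Finset.mem_range.mp hi)).indicator
        (h.pastSigma_mono (Finset.mem_range.mp hi).le _ (hA i))
    have hX := h.memLp_iterate hm n
    have hgm : Measurable[pastSigma M T n] ((A n).indicator Y) := hYm.indicator (hA n)
    have hg : MemLp ((A n).indicator Y) 2 μ := hY.indicator (hA' n)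
    have hcross : Integrable (fun ω => 2 * ((A n).indicator Y ω * m (T^[n] ω))) μ :=
      (hg.integrable_mul hX).const_mul 2
    have hsq : Integrable ((A n).indicator fun ω => m (T^[n] ω) ^ 2) μ :=
      hX.integrable_sq.indicator (hA' n)
    have e : ∀ ω, (∑ i ∈ Finset.range (n + 1), (A i).indicator (fun ω => m (T^[i] ω)) ω) ^ 2
        = Y ω ^ 2 + 2 * ((A n).indicator Y ω * m (T^[n] ω))
          + (A n).indicator (fun ω => m (T^[n] ω) ^ 2) ω := by
      intro ω
      rw [Finset.sum_range_succ]
      by_cases hω : ω ∈ A n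
      · simp only [Set.indicator_of_mem hω, Y]
        ring
      · simp only [Set.indicator_of_notMem hω, Y]
        ring
    have hsum : Integrable (fun ω => Y ω ^ 2 + 2 * ((A n).indicator Y ω * m (T^[n] ω))) μ :=
      hY.integrable_sq.add hcross
    simp only [e]
    rw [integral_add hsum hsq, integral_add hY.integrable_sq hcross, ih,
      integral_const_mul, h.integral_mul_iterate_eq_zero hm hgm hg, integral_indicator (hA' n),
      h.setIntegral_sq_iterate hm (hA n), Finset.sum_range_succ, integral_indicator (hA' n)]
    simp

/-! ### The good-λ inequality -/

theorem IsStationaryMDS.measurableSet_exceedSet_pastSigma (h : IsStationaryMDS M μ T m) (n : ℕ)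
    (x : ℝ) : MeasurableSet[pastSigma M T n] (exceedSet T m n x) := by
  have e : exceedSet T m n x = ⋃ k ∈ Set.Iic n, {ω | x < |partialSum T m k ω|} := by
    ext ω
    simp [exceedSet]
  rw [e]
  exact MeasurableSet.biUnion (Set.to_countable _) fun k hk =>
    (measurable_norm.comp (h.measurable_partialSum hk)) measurableSet_Ioi

theorem IsStationaryMDS.measurableSet_exceedSet (h : IsStationaryMDS M μ T m) (n : ℕ) (x : ℝ) :
    MeasurableSet (exceedSet T m n x) :=
  h.pastSigma_le n _ (h.measurableSet_exceedSet_pastSigma n x)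

theorem IsStationaryMDS.measurableSet_selectSet (h : IsStationaryMDS M μ T m) (x c : ℝ) (i : ℕ) :
    MeasurableSet[pastSigma M T i] (selectSet M μ T m x c i) := by
  refine MeasurableSet.inter (MeasurableSet.diff ?_ ?_) ?_
  · exact h.measurableSet_exceedSet_pastSigma i x
  · exact h.measurableSet_exceedSet_pastSigma i (2 * x)
  · exact h.measurable_partialSum_condVar i measurableSet_Iic

/-- The good-λ inequality for the maximal function of a stationary martingale. -/
theorem IsStationaryMDS.measure_exceedSet_two_mul_le [IsProbabilityMeasure μ]
    (h : IsStationaryMDS M μ T m) (hm : MemLp m 2 μ) (n : ℕ) {x δ : ℝ} (hx : 0 < x) (hδ : δ < 1) :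
    μ (exceedSet T m n (2 * x)) ≤ ENNReal.ofReal ((δ / (1 - δ)) ^ 2) * μ (exceedSet T m n x)
      + (n * μ {ω | δ * x < |m ω|} + μ {ω | (δ * x) ^ 2 < partialSum T (condVar M μ T m) n ω}) := by
  set c := (δ * x) ^ 2 with hc
  set A := selectSet M μ T m x c
  have hA : ∀ i, MeasurableSet[pastSigma M T i] (A i) := h.measurableSet_selectSet x c
  set Y : Ω → ℝ := fun ω => ∑ i ∈ Finset.range n, (A i).indicator (fun ω => m (T^[i] ω)) ω
  have hY : MemLp Y 2 μ := h.memLp_transform hm hA n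
  have hδ' : 0 < 1 - δ := sub_pos.mpr hδ
  have hnn : ∀ ω, 0 ≤ condVar M μ T m ω := fun ω => le_max_right _ _
  have hVmono : ∀ ω {i : ℕ}, i < n → partialSum T (condVar M μ T m) (i + 1) ω
      ≤ partialSum T (condVar M μ T m) n ω := fun ω i hi =>
    Finset.sum_le_sum_of_subset_of_nonneg (Finset.range_mono (Nat.succ_le_of_lt hi))
      fun _ _ _ => hnn _
  -- a large maximum without large increments or conditional variances makes the transform large
  have hsub : exceedSet T m n (2 * x) ⊆ {ω | ((1 - δ) * x) ^ 2 ≤ Y ω ^ 2} ∪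
      ((⋃ i ∈ Finset.range n, T^[i] ⁻¹' {ω | δ * x < |m ω|}) ∪
        {ω | c < partialSum T (condVar M μ T m) n ω}) := by
    intro ω hω
    by_contra hcon
    simp only [Set.mem_union, Set.mem_iUnion, Set.mem_ofPred_eq, Set.mem_preimage, not_or,
      not_exists, not_le, not_lt, Finset.mem_range] at hcon
    obtain ⟨hYω, hXω, hVω⟩ := hcon
    have hbig := le_abs_sum_between_levels (fun i => m (T^[i] ω)) hx hδ.le n hXω
      (fun i => (A i).indicator (fun ω => m (T^[i] ω)) ω)
      (fun i hi h1 h2 => Set.indicator_of_mem ?_ _)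
      (fun i hi h1 => Set.indicator_of_notMem ?_ _)
      (fun i hi h1 => Set.indicator_of_notMem ?_ _) hω
    · have := pow_le_pow_left₀ (by positivity) hbig 2
      rw [sq_abs] at this
      exact absurd this (not_le.mpr hYω)
    · exact ⟨⟨h1, fun ⟨k, hk, hk'⟩ => absurd (h2 k hk) (not_le.mpr hk')⟩,
        (hVmono ω hi).trans hVω⟩
    · rintro ⟨⟨⟨k, hk, hk'⟩, -⟩, -⟩
      exact absurd (h1 k hk) (not_le.mpr hk')
    · rintro ⟨⟨-, h2⟩, -⟩
      exact h2 h1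
  have hmoment : ∫ ω, Y ω ^ 2 ∂μ ≤ c * μ.real (exceedSet T m n x) := by
    rw [h.integral_transform_sq hm hA n]
    have hE := h.measurableSet_exceedSet n x
    have hint : Integrable ((exceedSet T m n x).indicator fun _ => c) μ :=
      (integrable_const c).indicator hE
    refine (integral_mono ?_ hint fun ω => ?_).trans_eq ?_
    · exact integrable_finsetSum _ fun i _ =>
        ((h.measurePreserving.iterate i).integrable_comp_of_integrable
          integrable_condExp).indicator (h.pastSigma_le i _ (hA i))
    · by_cases hω : ω ∈ exceedSet T m n x
      · rw [Set.indicator_of_mem hω]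
        refine sum_le_of_partial_sums_le (fun i => condVar M μ T m (T^[i] ω)) _ (sq_nonneg _)
          (fun i => ?_) (fun i hi => ?_) n
        · by_cases hωA : ω ∈ A i
          · rw [Set.indicator_of_mem hωA]
            exact le_max_left _ 0
          · rw [Set.indicator_of_notMem hωA]
            exact hnn _
        · rw [Set.indicator_of_notMem]
          rintro ⟨-, h2⟩
          exact absurd hi (not_lt.mpr h2)
      · rw [Set.indicator_of_notMem hω]
        refine Finset.sum_nonpos fun i hi => ?_
        rw [Set.indicator_of_notMem]
        rintro ⟨⟨⟨k, hk, hk'⟩, -⟩, -⟩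
        exact hω ⟨k, hk.trans (Finset.mem_range.mp hi).le, hk'⟩
    · rw [integral_indicator_const _ hE, smul_eq_mul, mul_comm]
  have hmarkov : μ {ω | ((1 - δ) * x) ^ 2 ≤ Y ω ^ 2}
      ≤ ENNReal.ofReal ((δ / (1 - δ)) ^ 2) * μ (exceedSet T m n x) := by
    have h1 := mul_meas_ge_le_integral_of_nonneg (ae_of_all μ fun ω => sq_nonneg (Y ω))
      hY.integrable_sq (((1 - δ) * x) ^ 2)
    have h2 : μ.real {ω | ((1 - δ) * x) ^ 2 ≤ Y ω ^ 2}
        ≤ (δ / (1 - δ)) ^ 2 * μ.real (exceedSet T m n x) := by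
      have hpos : 0 < ((1 - δ) * x) ^ 2 := by positivity
      rw [← mul_le_mul_iff_right₀ hpos]
      refine (h1.trans hmoment).trans_eq ?_
      rw [hc]
      field_simp
    rw [← ofReal_measureReal, ← ofReal_measureReal, ← ENNReal.ofReal_mul (sq_nonneg _)]
    exact ENNReal.ofReal_le_ofReal h2
  refine (measure_mono hsub).trans ((measure_union_le _ _).trans (add_le_add hmarkov ?_))
  refine (measure_union_le _ _).trans (add_le_add ?_ le_rfl)
  refine (measure_biUnion_finset_le _ _).trans_eq ?_
  have hm' : Measurable m := h.measurable.mono h.le le_rfl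
  have hms : MeasurableSet {ω | δ * x < |m ω|} := measurableSet_lt measurable_const hm'.abs
  rw [Finset.sum_congr rfl fun i _ =>
    (h.measurePreserving.iterate i).measure_preimage hms.nullMeasurableSet]
  simp

end Martingale

/-! ### Series of weighted tails -/

/-- A geometric series restricted to the terms below `z` is at most a multiple of `z`. -/
theorem tsum_ite_pow_lt_le (r z : ℝ≥0∞) :
    ∑' i : ℕ, (if r ^ i < z then r ^ i else 0) ≤ z * (1 - r)⁻¹ := by
  classical
  by_cases h : ∃ i, r ^ i < z
  · have hlt := Nat.find_spec h
    set i₀ := Nat.find h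
    calc ∑' i : ℕ, (if r ^ i < z then r ^ i else 0)
        = ∑ i ∈ Finset.range i₀, (if r ^ i < z then r ^ i else 0)
          + ∑' i : ℕ, (if r ^ (i + i₀) < z then r ^ (i + i₀) else 0) :=
          (ENNReal.summable.sum_add_tsum_nat_add' (k := i₀)).symm
      _ = ∑' i : ℕ, (if r ^ (i + i₀) < z then r ^ (i + i₀) else 0) := by
          rw [Finset.sum_eq_zero, zero_add]
          exact fun i hi => if_neg (Nat.find_min h (Finset.mem_range.mp hi))
      _ ≤ ∑' i : ℕ, z * r ^ i := by
          refine ENNReal.tsum_le_tsum fun i => ?_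
          split_ifs
          · rw [pow_add, mul_comm]
            gcongr
          · exact zero_le
      _ = z * (1 - r)⁻¹ := by rw [ENNReal.tsum_mul_left, ENNReal.tsum_geometric]
  · push Not at h
    have : ∀ i, ¬ r ^ i < z := fun i => not_lt.mpr (h i)
    simp [this]

/-- With `β = 2 ^ (-2 / p)`, the levels `b β^i` and the weights `2^{-i}`: the weights are summed
over the levels below `v`, each divided by its level. -/
theorem tsum_level_le {p : ℝ} (hp : 2 < p) {b v : ℝ} (hb : 0 < b) (hv : 0 ≤ v) :
    ∑' i : ℕ, (2⁻¹ : ℝ≥0∞) ^ i * ((ENNReal.ofReal (b * ((2 : ℝ) ^ i) ^ (-(2 / p))))⁻¹ *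
        (if b * ((2 : ℝ) ^ i) ^ (-(2 / p)) < v then ENNReal.ofReal v else 0))
      ≤ ENNReal.ofReal (b ^ (-(p / 2))) * (1 - ENNReal.ofReal (2 ^ (-(1 - 2 / p))))⁻¹
        * ENNReal.ofReal v ^ (p / 2) := by
  have hp0 : 0 < p := by linarith
  set r := ENNReal.ofReal (2 ^ (-(1 - 2 / p))) with hr
  set z := ENNReal.ofReal ((v / b) ^ (p / 2 - 1)) with hz
  have hri : ∀ i : ℕ, r ^ i = ENNReal.ofReal (((2 : ℝ) ^ i) ^ (-(1 - 2 / p))) := fun i => by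
    rw [hr, ← ENNReal.ofReal_pow (by positivity), ← Real.rpow_natCast, ← Real.rpow_natCast,
      ← Real.rpow_mul zero_le_two, ← Real.rpow_mul zero_le_two, mul_comm]
  have hterm : ∀ i : ℕ, (2⁻¹ : ℝ≥0∞) ^ i * ((ENNReal.ofReal (b * ((2 : ℝ) ^ i) ^ (-(2 / p))))⁻¹ *
      (if b * ((2 : ℝ) ^ i) ^ (-(2 / p)) < v then ENNReal.ofReal v else 0))
      ≤ ENNReal.ofReal (v / b) * (if r ^ i < z then r ^ i else 0) := by
    intro i
    split_ifs with h1 h2 h2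
    · have h2i : (2⁻¹ : ℝ≥0∞) ^ i = ENNReal.ofReal (((2 : ℝ) ^ i)⁻¹) := by
        rw [← inv_pow, ENNReal.ofReal_pow (by positivity), ENNReal.ofReal_inv_of_pos two_pos,
          ENNReal.ofReal_ofNat]
      have hpos : 0 < b * ((2 : ℝ) ^ i) ^ (-(2 / p)) := by positivity
      rw [h2i, hri, ← ENNReal.ofReal_inv_of_pos hpos, ← ENNReal.ofReal_mul (by positivity),
        ← ENNReal.ofReal_mul (by positivity), ← ENNReal.ofReal_mul (by positivity)]
      refine (ENNReal.ofReal_le_ofReal (le_of_eq ?_))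
      have e : ((2 : ℝ) ^ i) ^ (-(1 - 2 / p)) = ((2 : ℝ) ^ i)⁻¹ * (((2 : ℝ) ^ i) ^ (-(2 / p)))⁻¹ := by
        rw [← Real.rpow_neg_one, ← Real.rpow_neg (by positivity), ← Real.rpow_add (by positivity)]
        congr 1
        ring
      rw [e]
      field_simp
    · refine absurd ?_ h2
      rw [hri, hz]
      have hlt : ((2 : ℝ) ^ i) ^ (-(2 / p)) < v / b := by
        rw [lt_div_iff₀ hb]
        linarith
      have hpos : (0 : ℝ) < ((2 : ℝ) ^ i) ^ (-(2 / p)) := by positivity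
      rw [ENNReal.ofReal_lt_ofReal_iff (Real.rpow_pos_of_pos (hpos.trans hlt) _)]
      have e : ((2 : ℝ) ^ i) ^ (-(1 - 2 / p)) = (((2 : ℝ) ^ i) ^ (-(2 / p))) ^ (p / 2 - 1) := by
        rw [← Real.rpow_mul (by positivity)]
        congr 1
        field_simp
      rw [e]
      exact Real.rpow_lt_rpow hpos.le hlt (by linarith)
    · simp
    · simp
  refine (ENNReal.tsum_le_tsum hterm).trans ?_
  rw [ENNReal.tsum_mul_left]
  refine (mul_le_mul_right (tsum_ite_pow_lt_le r z) _).trans_eq ?_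
  rw [← mul_assoc, hz, ← ENNReal.ofReal_mul (by positivity),
    ENNReal.ofReal_rpow_of_nonneg hv (by positivity), mul_right_comm,
    ← ENNReal.ofReal_mul (by positivity)]
  congr 2
  have hvb : 0 ≤ v / b := by positivity
  have e : v / b * (v / b) ^ (p / 2 - 1) = (v / b) ^ (p / 2) := by
    conv_lhs => rw [← Real.rpow_one_add' hvb (by linarith)]
    congr 1
    ring
  rw [e, Real.div_rpow hv hb.le, Real.rpow_neg hb.le]
  ring

/-- A bounded function with `F (2 x) ≤ ε F x + K x^{-p}` decays like `x^{-p}` if `ε` is small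
compared with `2^{-p}`. -/
theorem le_rpow_of_contraction {p ε : ℝ} (hε0 : 0 ≤ ε) (hε : ε * 2 ^ (p + 1) ≤ 1) (hp : 0 < p)
    {F : ℝ → ℝ≥0∞} {B K : ℝ≥0∞} (hB : B ≠ ∞) (hF : ∀ x, F x ≤ B)
    (hstep : ∀ x, 0 < x → F (2 * x) ≤ ENNReal.ofReal ε * F x + K * ENNReal.ofReal (x ^ (-p)))
    {x : ℝ} (hx : 0 < x) :
    F x ≤ ENNReal.ofReal (2 ^ (p + 1)) * K * ENNReal.ofReal (x ^ (-p)) := by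
  have key : ∀ k : ℕ, ∀ x, 0 < x → F x ≤ ENNReal.ofReal ε ^ k * B
      + ENNReal.ofReal (2 ^ (p + 1)) * K * ENNReal.ofReal (x ^ (-p)) := by
    intro k
    induction k with
    | zero =>
      intro x _
      rw [pow_zero, one_mul]
      exact (hF x).trans le_self_add
    | succ k ih =>
      intro x hx
      have hx2 : 0 < x / 2 := by positivity
      have h1 := hstep (x / 2) hx2
      rw [mul_div_cancel₀ x two_ne_zero] at h1
      refine h1.trans ((add_le_add_left (mul_le_mul_right (ih _ hx2) _) _).trans ?_)
      rw [mul_add, ← mul_assoc, ← pow_succ', add_assoc]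
      refine add_le_add_right ?_ _
      have e : ENNReal.ofReal (2 ^ (p + 1)) * K * ENNReal.ofReal (x ^ (-p))
          = 2 * (K * ENNReal.ofReal ((x / 2) ^ (-p))) := by
        rw [mul_comm _ K, mul_assoc, mul_left_comm 2 K, ← ENNReal.ofReal_mul (by positivity),
          ← ENNReal.ofReal_ofNat 2, ← ENNReal.ofReal_mul zero_le_two]
        congr 2
        rw [Real.div_rpow hx.le zero_le_two, Real.rpow_add two_pos, Real.rpow_neg zero_le_two]
        simp
        ring
      have e2 : ENNReal.ofReal ε *
          (ENNReal.ofReal (2 ^ (p + 1)) * K * ENNReal.ofReal ((x / 2) ^ (-p)))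
          ≤ K * ENNReal.ofReal ((x / 2) ^ (-p)) := by
        rw [mul_assoc, ← mul_assoc, ← ENNReal.ofReal_mul hε0]
        exact mul_le_of_le_one_left zero_le (ENNReal.ofReal_le_one.mpr hε)
      rw [e, two_mul]
      exact add_le_add_left e2 _
  have hε1 : ENNReal.ofReal ε < 1 := by
    rw [ENNReal.ofReal_lt_one]
    have : (1 : ℝ) < 2 ^ (p + 1) := Real.one_lt_rpow one_lt_two (by linarith)
    nlinarith
  have hlim : Tendsto (fun k : ℕ => ENNReal.ofReal ε ^ k * B
      + ENNReal.ofReal (2 ^ (p + 1)) * K * ENNReal.ofReal (x ^ (-p))) atTop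
      (𝓝 (0 * B + ENNReal.ofReal (2 ^ (p + 1)) * K * ENNReal.ofReal (x ^ (-p)))) :=
    (ENNReal.Tendsto.mul_const (ENNReal.tendsto_pow_atTop_nhds_zero_of_lt_one hε1)
      (Or.inr hB)).add tendsto_const_nhds
  rw [zero_mul, zero_add] at hlim
  exact ge_of_tendsto' hlim fun k => key k x hx

/-! ### Moment and tail bounds -/

section Tails

variable {Ω : Type*} {M : MeasurableSpace Ω} [mΩ : MeasurableSpace Ω] {μ : Measure Ω}
  {T : Ω ≃ᵐ Ω} {m : Ω → ℝ}

theorem measure_lt_abs_le_weakNormPow (p : ℝ) (m : Ω → ℝ) {t : ℝ} (ht : 0 < t) :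
    μ {ω | t < |m ω|} ≤ weakNormPow p (fun ω => ENNReal.ofReal |m ω|) μ
      * ENNReal.ofReal (t ^ (-p)) := by
  have h1 : ENNReal.ofReal (t ^ p) * μ {ω | t < |m ω|}
      ≤ weakNormPow p (fun ω => ENNReal.ofReal |m ω|) μ := by
    have := le_iSup₂ (f := fun (t : ℝ) (_ : 0 < t) => ENNReal.ofReal (t ^ p)
      * μ {ω | ENNReal.ofReal t < ENNReal.ofReal |m ω|}) t ht
    simp only [ENNReal.ofReal_lt_ofReal_iff_of_nonneg ht.le] at this
    exact this
  have htp : 0 < t ^ p := Real.rpow_pos_of_pos ht p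
  rw [Real.rpow_neg ht.le, ENNReal.ofReal_inv_of_pos htp, ← div_eq_mul_inv,
    ENNReal.le_div_iff_mul_le (Or.inl (by simpa using htp)) (Or.inl ENNReal.ofReal_ne_top),
    mul_comm]
  exact h1

theorem memLp_two_of_weakNormPow_ne_top [IsProbabilityMeasure μ] {p : ℝ} (hp : 2 < p)
    (hm : Measurable m) (hA : weakNormPow p (fun ω => ENNReal.ofReal |m ω|) μ ≠ ∞) :
    MemLp m 2 μ := by
  set A := weakNormPow p (fun ω => ENNReal.ofReal |m ω|) μ
  have hs : ∀ k : ℕ, MeasurableSet {ω | 2 ^ k / 2 < |m ω|} := fun k =>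
    measurableSet_lt measurable_const hm.abs
  -- the level is halved because the weak norm controls strict superlevel sets only
  have hpt : ∀ ω, ENNReal.ofReal (m ω ^ 2) ≤ 1 + ∑' k : ℕ,
      {ω | 2 ^ k / 2 < |m ω|}.indicator (fun _ => ENNReal.ofReal (4 * 4 ^ k)) ω := by
    intro ω
    rcases le_or_gt |m ω| 1 with h | h
    · refine le_add_right (ENNReal.ofReal_le_one.mpr ?_)
      exact (sq_le_one_iff_abs_le_one _).mpr h
    · obtain ⟨k, hk1, hk2⟩ := exists_nat_pow_near h.le (one_lt_two (α := ℝ))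
      refine le_add_left (le_trans ?_ (ENNReal.le_tsum k))
      have hpos : (0 : ℝ) < 2 ^ k := by positivity
      rw [Set.indicator_of_mem (show ω ∈ {ω | 2 ^ k / 2 < |m ω|} from by
        show (2 : ℝ) ^ k / 2 < |m ω|
        linarith)]
      refine ENNReal.ofReal_le_ofReal ?_
      rw [← sq_abs]
      calc |m ω| ^ 2 ≤ (2 ^ (k + 1)) ^ 2 := pow_le_pow_left₀ (abs_nonneg _) hk2.le 2
        _ = 4 * 4 ^ k := by
          rw [show (4 : ℝ) = 2 ^ 2 by norm_num, ← pow_mul, ← pow_mul, ← pow_add]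
          congr 1
          ring
  have hr : ENNReal.ofReal (4 * 2 ^ (-p)) < 1 := by
    rw [ENNReal.ofReal_lt_one]
    calc (4 : ℝ) * 2 ^ (-p) < 4 * 2 ^ (-2 : ℝ) := by
          refine mul_lt_mul_of_pos_left ?_ (by norm_num)
          exact Real.rpow_lt_rpow_of_exponent_lt one_lt_two (by linarith)
      _ = 1 := by norm_num [Real.rpow_neg]
  have hfin : ∫⁻ ω, ENNReal.ofReal (m ω ^ 2) ∂μ < ∞ := by
    refine (lintegral_mono hpt).trans_lt ?_
    rw [lintegral_add_left measurable_const, lintegral_tsum fun k =>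
      (measurable_const.indicator (hs k)).aemeasurable]
    simp only [lintegral_indicator_const (hs _), lintegral_const, measure_univ, mul_one]
    refine ENNReal.add_lt_top.mpr ⟨ENNReal.one_lt_top, ?_⟩
    have hk : ∀ k : ℕ, ENNReal.ofReal (4 * 4 ^ k) * μ {ω | 2 ^ k / 2 < |m ω|}
        ≤ A * ENNReal.ofReal (4 * 2 ^ p) * ENNReal.ofReal (4 * 2 ^ (-p)) ^ k := by
      intro k
      refine (mul_le_mul_right (measure_lt_abs_le_weakNormPow p m (by positivity)) _).trans_eq ?_
      rw [mul_left_comm, ← ENNReal.ofReal_mul (by positivity), mul_assoc A,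
        ← ENNReal.ofReal_pow (by positivity), ← ENNReal.ofReal_mul (by positivity)]
      congr 2
      rw [Real.div_rpow (by positivity) zero_le_two, mul_pow, ← Real.rpow_natCast,
        ← Real.rpow_natCast, ← Real.rpow_natCast, ← Real.rpow_mul zero_le_two,
        ← Real.rpow_mul zero_le_two, mul_comm (k : ℝ), Real.rpow_neg zero_le_two p]
      field_simp
    refine (ENNReal.tsum_le_tsum hk).trans_lt ?_
    rw [ENNReal.tsum_mul_left, ENNReal.tsum_geometric]
    exact ENNReal.mul_lt_top (ENNReal.mul_lt_top hA.lt_top ENNReal.ofReal_lt_top)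
      (ENNReal.inv_lt_top.mpr (tsub_pos_of_lt hr))
  rw [memLp_two_iff_integrable_sq hm.aestronglyMeasurable]
  exact ⟨(hm.pow_const 2).aestronglyMeasurable,
    (hasFiniteIntegral_iff_ofReal (ae_of_all _ fun ω => sq_nonneg (m ω))).mpr hfin⟩

/-- Truncating at the level `a` and applying Markov's inequality to the part above `a` controls
the tail of an ergodic average without a maximal inequality. -/
theorem measure_lt_partialSum_le {w : Ω → ℝ} (hT : MeasurePreserving T μ μ) (hw : Measurable w)
    {n : ℕ} (hn : 1 ≤ n) {a : ℝ} (ha : 0 < a) :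
    μ {ω | 2 * a * n < partialSum T w n ω} ≤ (ENNReal.ofReal a)⁻¹
      * ∫⁻ ω, (if a < w ω then ENNReal.ofReal (w ω) else 0) ∂μ := by
  set U : Ω → ℝ≥0∞ := fun ω => if a < w ω then ENNReal.ofReal (w ω) else 0
  have hU : Measurable U :=
    Measurable.ite (measurableSet_lt measurable_const hw) hw.ennreal_ofReal measurable_const
  have hn0 : (0 : ℝ) < n := by exact_mod_cast hn
  have hUT : ∀ i, Measurable fun ω => U (T^[i] ω) := fun i => hU.comp (hT.iterate i).measurable
  have hsub : {ω | 2 * a * n < partialSum T w n ω}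
      ⊆ {ω | ENNReal.ofReal (a * n) ≤ ∑ i ∈ Finset.range n, U (T^[i] ω)} := by
    intro ω hω
    have hω' : 2 * a * n < partialSum T w n ω := hω
    have h1 : ∀ x, w x ≤ a + if a < w x then w x else 0 := fun x => by
      split_ifs with h
      · linarith
      · linarith
    have h2 : partialSum T w n ω
        ≤ n * a + ∑ i ∈ Finset.range n, (if a < w (T^[i] ω) then w (T^[i] ω) else 0) := by
      refine (Finset.sum_le_sum fun i _ => h1 (T^[i] ω)).trans_eq ?_
      rw [Finset.sum_add_distrib]
      simp
    have h3 : ∑ i ∈ Finset.range n, U (T^[i] ω) = ENNReal.ofReal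
        (∑ i ∈ Finset.range n, (if a < w (T^[i] ω) then w (T^[i] ω) else 0)) := by
      rw [ENNReal.ofReal_sum_of_nonneg fun i _ => ?_]
      · refine Finset.sum_congr rfl fun i _ => ?_
        simp only [U]
        split_ifs <;> simp
      · split_ifs with h
        · linarith
        · exact le_rfl
    show ENNReal.ofReal (a * n) ≤ ∑ i ∈ Finset.range n, U (T^[i] ω)
    rw [h3]
    exact ENNReal.ofReal_le_ofReal (by linarith)
  refine (measure_mono hsub).trans ?_
  have hmarkov := mul_meas_ge_le_lintegral (μ := μ)
    (Finset.measurable_sum (Finset.range n) fun i _ => hUT i) (ENNReal.ofReal (a * n))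
  rw [lintegral_finsetSum _ fun i _ => hUT i,
    Finset.sum_congr rfl fun i _ => (hT.iterate i).lintegral_comp hU, Finset.sum_const,
    Finset.card_range, nsmul_eq_mul, ENNReal.ofReal_mul ha.le, ENNReal.ofReal_natCast,
    mul_comm (ENNReal.ofReal a), mul_assoc] at hmarkov
  have hn' : (n : ℝ≥0∞) ≠ 0 := by exact_mod_cast (by omega : n ≠ 0)
  rw [ENNReal.mul_le_mul_iff_right hn' (ENNReal.natCast_ne_top n),
    ← ENNReal.ofReal_natCast, ← ENNReal.ofReal_mul hn0.le, mul_comm (n : ℝ)] at hmarkov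
  rwa [mul_comm _ (lintegral _ _), ← div_eq_mul_inv,
    ENNReal.le_div_iff_mul_le (Or.inl (by simpa using ha)) (Or.inl ENNReal.ofReal_ne_top), mul_comm]

end Tails

/-! ### The dyadic tail series -/

section Series

variable {Ω : Type*} {M : MeasurableSpace Ω} [mΩ : MeasurableSpace Ω] {μ : Measure Ω}
  {T : Ω ≃ᵐ Ω} {m : Ω → ℝ}

theorem tsum_measure_lt_abs_le (m : Ω → ℝ) {p α : ℝ} {y : ℝ} (hy : 0 < y) :
    ∑' i : ℕ, μ {ω | y * ((2 : ℝ) ^ i) ^ α < |m ω|}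
      ≤ ENNReal.ofReal (y ^ (-p)) * (1 - ENNReal.ofReal (2 ^ (-(α * p))))⁻¹
        * weakNormPow p (fun ω => ENNReal.ofReal |m ω|) μ := by
  have hi : ∀ i : ℕ, μ {ω | y * ((2 : ℝ) ^ i) ^ α < |m ω|}
      ≤ weakNormPow p (fun ω => ENNReal.ofReal |m ω|) μ * ENNReal.ofReal (y ^ (-p))
        * ENNReal.ofReal (2 ^ (-(α * p))) ^ i := by
    intro i
    refine (measure_lt_abs_le_weakNormPow p m (by positivity)).trans_eq ?_
    rw [mul_assoc, ← ENNReal.ofReal_pow (by positivity), ← ENNReal.ofReal_mul (by positivity),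
      Real.mul_rpow hy.le (by positivity), ← Real.rpow_natCast, ← Real.rpow_natCast,
      ← Real.rpow_mul zero_le_two, ← Real.rpow_mul zero_le_two, ← Real.rpow_mul zero_le_two]
    congr 4
    ring
  refine (ENNReal.tsum_le_tsum hi).trans_eq ?_
  rw [ENNReal.tsum_mul_left, ENNReal.tsum_geometric]
  ring

theorem condVarMoment_eq_lintegral_condVar (p : ℝ) : condVarMoment M p μ T m
    = ∫⁻ ω, ENNReal.ofReal (condVar M μ T m ω) ^ (p / 2) ∂μ := by
  refine lintegral_congr fun ω => ?_
  rw [condVar, ENNReal.ofReal_max, ENNReal.ofReal_zero, max_eq_left zero_le]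

theorem IsStationaryMDS.tsum_measure_lt_partialSum_condVar_le [IsProbabilityMeasure μ]
    (h : IsStationaryMDS M μ T m) {p : ℝ} (hp : 2 < p) {y : ℝ} (hy : 0 < y) :
    ∑' i : ℕ, (2⁻¹ : ℝ≥0∞) ^ i * μ {ω | (y * ((2 : ℝ) ^ i) ^ (1 / 2 - 1 / p)) ^ 2
        < partialSum T (condVar M μ T m) (2 ^ i) ω}
      ≤ ENNReal.ofReal ((y ^ 2 / 2) ^ (-(p / 2)))
        * (1 - ENNReal.ofReal (2 ^ (-(1 - 2 / p))))⁻¹ * condVarMoment M p μ T m := by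
  have hb : 0 < y ^ 2 / 2 := by positivity
  have hw : Measurable (condVar M μ T m) :=
    measurable_condVar.mono (h.image_le.trans h.le) le_rfl
  set w := condVar M μ T m
  set b := y ^ 2 / 2 with hb_def
  have hlevel : ∀ i : ℕ, (y * ((2 : ℝ) ^ i) ^ (1 / 2 - 1 / p)) ^ 2
      = 2 * (b * ((2 : ℝ) ^ i) ^ (-(2 / p))) * ((2 ^ i : ℕ) : ℝ) := by
    intro i
    have h2 : (0 : ℝ) < 2 ^ i := by positivity
    have e : (((2 : ℝ) ^ i) ^ (1 / 2 - 1 / p)) ^ 2 = ((2 : ℝ) ^ i) ^ (-(2 / p)) * 2 ^ i := by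
      rw [← Real.rpow_mul_natCast h2.le]
      conv_rhs => rw [← Real.rpow_add_one h2.ne']
      congr 1
      push_cast
      ring
    rw [mul_pow, e, hb_def]
    push_cast
    ring
  have hterm : ∀ i : ℕ, (2⁻¹ : ℝ≥0∞) ^ i * μ {ω | (y * ((2 : ℝ) ^ i) ^ (1 / 2 - 1 / p)) ^ 2
        < partialSum T w (2 ^ i) ω}
      ≤ ∫⁻ ω, (2⁻¹ : ℝ≥0∞) ^ i * ((ENNReal.ofReal (b * ((2 : ℝ) ^ i) ^ (-(2 / p))))⁻¹ *
        (if b * ((2 : ℝ) ^ i) ^ (-(2 / p)) < w ω then ENNReal.ofReal (w ω) else 0)) ∂μ := by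
    intro i
    have hpos : 0 < b * ((2 : ℝ) ^ i) ^ (-(2 / p)) := by positivity
    have hm : Measurable fun ω =>
        if b * ((2 : ℝ) ^ i) ^ (-(2 / p)) < w ω then ENNReal.ofReal (w ω) else 0 :=
      Measurable.ite (measurableSet_lt measurable_const hw) hw.ennreal_ofReal measurable_const
    rw [lintegral_const_mul _ (hm.const_mul _), lintegral_const_mul _ hm, hlevel]
    exact mul_le_mul_right
      (measure_lt_partialSum_le h.measurePreserving hw Nat.one_le_two_pow hpos) _
  refine (ENNReal.tsum_le_tsum hterm).trans ?_
  rw [← lintegral_tsum fun i => ?_]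
  · refine (lintegral_mono fun ω => tsum_level_le hp hb (v := w ω) (le_max_right _ _)).trans_eq ?_
    rw [lintegral_const_mul _ (hw.ennreal_ofReal.pow_const _), condVarMoment_eq_lintegral_condVar]
  · exact (((Measurable.ite (measurableSet_lt measurable_const hw) hw.ennreal_ofReal
      measurable_const).const_mul _).const_mul _).aemeasurable

/-- The weighted series, over the dyadic scales, of the probabilities that the maximal function of
the martingale is large at the scale-invariant level. -/
noncomputable def tailSeries (μ : Measure Ω) (T : Ω ≃ᵐ Ω) (m : Ω → ℝ) (α x : ℝ) : ℝ≥0∞ :=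
  ∑' i : ℕ, (2⁻¹ : ℝ≥0∞) ^ i * μ (exceedSet T m (2 ^ i) (x * ((2 : ℝ) ^ i) ^ α))

theorem tailSeries_le_two [IsProbabilityMeasure μ] (α x : ℝ) : tailSeries μ T m α x ≤ 2 := by
  calc tailSeries μ T m α x ≤ ∑' i : ℕ, (2⁻¹ : ℝ≥0∞) ^ i :=
        ENNReal.tsum_le_tsum fun i => mul_le_of_le_one_right zero_le prob_le_one
    _ = 2 := by rw [ENNReal.tsum_geometric, ENNReal.one_sub_inv_two, inv_inv]

/-- The ratio of the truncation level to the level of the maximal function for which the good-λ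
inequality contracts by the factor `2^{-p-1}`. -/
noncomputable def contractionRatio (p : ℝ) : ℝ := 2 ^ (-((p + 3) / 2))

theorem contractionRatio_pos (p : ℝ) : 0 < contractionRatio p := Real.rpow_pos_of_pos two_pos _

theorem contractionRatio_le_half {p : ℝ} (hp : 0 < p) : contractionRatio p ≤ 1 / 2 :=
  calc contractionRatio p ≤ 2 ^ (-1 : ℝ) :=
        Real.rpow_le_rpow_of_exponent_le one_le_two (by linarith)
    _ = 1 / 2 := by rw [Real.rpow_neg_one, one_div]

theorem contractionRatio_sq_mul_le {p : ℝ} (hp : 0 < p) :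
    (contractionRatio p / (1 - contractionRatio p)) ^ 2 * 2 ^ (p + 1) ≤ 1 := by
  have h0 := contractionRatio_pos p
  have h1 := contractionRatio_le_half hp
  have hsq : contractionRatio p ^ 2 = 2 ^ (-(p + 3)) := by
    rw [contractionRatio, ← Real.rpow_mul_natCast zero_le_two]
    congr 1
    push_cast
    ring
  have h2 : contractionRatio p / (1 - contractionRatio p) ≤ 2 * contractionRatio p := by
    rw [div_le_iff₀ (by linarith)]
    nlinarith
  calc (contractionRatio p / (1 - contractionRatio p)) ^ 2 * 2 ^ (p + 1)
      ≤ (2 * contractionRatio p) ^ 2 * 2 ^ (p + 1) := by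
        have : 0 ≤ contractionRatio p / (1 - contractionRatio p) :=
          div_nonneg h0.le (by linarith)
        gcongr
    _ = 4 * (2 ^ (-(p + 3)) * 2 ^ (p + 1)) := by rw [mul_pow, hsq]; ring
    _ = 1 := by
        rw [← Real.rpow_add two_pos, show -(p + 3) + (p + 1) = (-2 : ℝ) by ring]
        norm_num [Real.rpow_neg]

/-- The constant in front of the moments in the recursion for `tailSeries`. -/
noncomputable def tailConst (p : ℝ) : ℝ≥0∞ :=
  ENNReal.ofReal (contractionRatio p ^ (-p))
      * (1 - ENNReal.ofReal (2 ^ (-((1 / 2 - 1 / p) * p))))⁻¹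
    + ENNReal.ofReal ((contractionRatio p ^ 2 / 2) ^ (-(p / 2)))
      * (1 - ENNReal.ofReal (2 ^ (-(1 - 2 / p))))⁻¹

theorem tailConst_ne_top {p : ℝ} (hp : 2 < p) : tailConst p ≠ ∞ := by
  have hinv : ∀ q : ℝ, 0 < q → (1 - ENNReal.ofReal (2 ^ (-q)))⁻¹ ≠ ∞ := by
    intro q hq
    refine ENNReal.inv_ne_top.mpr (tsub_pos_of_lt ?_).ne'
    rw [ENNReal.ofReal_lt_one]
    exact Real.rpow_lt_one_of_one_lt_of_neg one_lt_two (by linarith)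
  have hp0 : 0 < p := by linarith
  refine ENNReal.add_ne_top.mpr ⟨ENNReal.mul_ne_top ENNReal.ofReal_ne_top (hinv _ ?_),
    ENNReal.mul_ne_top ENNReal.ofReal_ne_top (hinv _ ?_)⟩
  · have : (1 / 2 - 1 / p) * p = p / 2 - 1 := by field_simp
    linarith
  · have : 2 / p < 1 := by rwa [div_lt_one hp0]
    linarith

theorem tailConst_ne_zero (p : ℝ) : tailConst p ≠ 0 := by
  have hδ := contractionRatio_pos p
  refine fun h0 => ?_
  have h1 := (add_eq_zero.mp h0).1
  rw [mul_eq_zero, ENNReal.ofReal_eq_zero, ENNReal.inv_eq_zero] at h1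
  rcases h1 with h1 | h1
  · exact absurd (Real.rpow_pos_of_pos hδ (-p)) (not_lt.mpr h1)
  · exact absurd h1 (ne_top_of_le_ne_top ENNReal.one_ne_top tsub_le_self)

theorem IsStationaryMDS.tailSeries_two_mul_le [IsProbabilityMeasure μ]
    (h : IsStationaryMDS M μ T m) (hm : MemLp m 2 μ) {p : ℝ} (hp : 2 < p) {x : ℝ} (hx : 0 < x) :
    tailSeries μ T m (1 / 2 - 1 / p) (2 * x)
      ≤ ENNReal.ofReal ((contractionRatio p / (1 - contractionRatio p)) ^ 2)
          * tailSeries μ T m (1 / 2 - 1 / p) x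
        + tailConst p * (weakNormPow p (fun ω => ENNReal.ofReal |m ω|) μ
            + condVarMoment M p μ T m) * ENNReal.ofReal (x ^ (-p)) := by
  have hδ := contractionRatio_pos p
  have hδ1 := contractionRatio_le_half (by linarith : 0 < p)
  set δ := contractionRatio p with hδ_def
  set α := 1 / 2 - 1 / p with hα
  set a := weakNormPow p (fun ω => ENNReal.ofReal |m ω|) μ
  set B := condVarMoment M p μ T m
  have hscale : ∀ i : ℕ, (2⁻¹ : ℝ≥0∞) ^ i * ((2 ^ i : ℕ) : ℝ≥0∞) = 1 := fun i => by
    push_cast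
    rw [← mul_pow, ENNReal.inv_mul_cancel two_ne_zero ENNReal.ofNat_ne_top, one_pow]
  have hstep : ∀ i : ℕ, (2⁻¹ : ℝ≥0∞) ^ i * μ (exceedSet T m (2 ^ i) (2 * x * ((2 : ℝ) ^ i) ^ α))
      ≤ ENNReal.ofReal ((δ / (1 - δ)) ^ 2)
          * ((2⁻¹ : ℝ≥0∞) ^ i * μ (exceedSet T m (2 ^ i) (x * ((2 : ℝ) ^ i) ^ α)))
        + (μ {ω | δ * x * ((2 : ℝ) ^ i) ^ α < |m ω|}
          + (2⁻¹ : ℝ≥0∞) ^ i * μ {ω | (δ * x * ((2 : ℝ) ^ i) ^ α) ^ 2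
            < partialSum T (condVar M μ T m) (2 ^ i) ω}) := by
    intro i
    have hxi : 0 < x * ((2 : ℝ) ^ i) ^ α := by positivity
    have := mul_le_mul_right (h.measure_exceedSet_two_mul_le hm (2 ^ i) hxi
      (by linarith : δ < 1)) ((2⁻¹ : ℝ≥0∞) ^ i)
    rw [mul_add, mul_add, ← mul_assoc _ (((2 ^ i : ℕ) : ℝ≥0∞)), hscale, one_mul,
      mul_left_comm _ (ENNReal.ofReal _)] at this
    simpa only [mul_assoc] using this
  have hδx : 0 < δ * x := by positivity
  refine (ENNReal.tsum_le_tsum hstep).trans ?_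
  rw [ENNReal.tsum_add, ENNReal.tsum_mul_left, ENNReal.tsum_add]
  refine add_le_add_right ?_ _
  refine (add_le_add (tsum_measure_lt_abs_le (p := p) m hδx)
    (h.tsum_measure_lt_partialSum_condVar_le hp hδx)).trans ?_
  have e1 : ENNReal.ofReal ((δ * x) ^ (-p))
      = ENNReal.ofReal (δ ^ (-p)) * ENNReal.ofReal (x ^ (-p)) := by
    rw [Real.mul_rpow hδ.le hx.le, ENNReal.ofReal_mul (by positivity)]
  have e2 : ENNReal.ofReal (((δ * x) ^ 2 / 2) ^ (-(p / 2)))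
      = ENNReal.ofReal ((δ ^ 2 / 2) ^ (-(p / 2))) * ENNReal.ofReal (x ^ (-p)) := by
    rw [← ENNReal.ofReal_mul (by positivity), mul_pow, mul_div_right_comm,
      Real.mul_rpow (by positivity) (by positivity), ← Real.rpow_natCast_mul hx.le]
    congr 3
    push_cast
    ring
  rw [e1, e2, tailConst, ← hα, ← hδ_def]
  set c1 := ENNReal.ofReal (δ ^ (-p))
  set c2 := ENNReal.ofReal ((δ ^ 2 / 2) ^ (-(p / 2)))
  set d1 := (1 - ENNReal.ofReal (2 ^ (-(α * p))))⁻¹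
  set d2 := (1 - ENNReal.ofReal (2 ^ (-(1 - 2 / p))))⁻¹
  set X := ENNReal.ofReal (x ^ (-p))
  calc c1 * X * d1 * a + c2 * X * d2 * B = (c1 * d1 * a + c2 * d2 * B) * X := by ring
    _ ≤ ((c1 * d1 + c2 * d2) * (a + B)) * X := by
        gcongr
        calc c1 * d1 * a + c2 * d2 * B
            ≤ (c1 * d1 + c2 * d2) * a + (c1 * d1 + c2 * d2) * B := by
              gcongr
              · exact le_self_add
              · exact le_add_self
          _ = (c1 * d1 + c2 * d2) * (a + B) := by ring

theorem IsStationaryMDS.tailSeries_le [IsProbabilityMeasure μ]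
    (h : IsStationaryMDS M μ T m) (hm : MemLp m 2 μ) {p : ℝ} (hp : 2 < p) {x : ℝ} (hx : 0 < x) :
    tailSeries μ T m (1 / 2 - 1 / p) x
      ≤ ENNReal.ofReal (2 ^ (p + 1)) * (tailConst p
        * (weakNormPow p (fun ω => ENNReal.ofReal |m ω|) μ + condVarMoment M p μ T m))
        * ENNReal.ofReal (x ^ (-p)) :=
  le_rpow_of_contraction (sq_nonneg _) (contractionRatio_sq_mul_le (by linarith)) (by linarith)
    (ENNReal.ofNat_ne_top (n := 2)) (tailSeries_le_two _)
    (fun _ hx => h.tailSeries_two_mul_le hm hp hx) hx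

/-- The dyadic blocks of length `2^i ≤ 2 n` that meet `[0, n]` number at most `3 n 2^{-i}`, and by
stationarity the martingale oscillates on each of them as on the first one. -/
theorem IsStationaryMDS.measure_lt_holderNorm_le [IsProbabilityMeasure μ]
    (h : IsStationaryMDS M μ T m) {α : ℝ} (hα0 : 0 ≤ α) (hα1 : α ≤ 1) {n : ℕ} (hn : 1 ≤ n)
    (D : ℝ) :
    μ {ω | ENNReal.ofReal (6 * D * (n : ℝ) ^ (α - 1 / 2))
        < holderNorm α (normalizedPolygonalSum T m n ω)} ≤ 3 * n * tailSeries μ T m α D := by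
  set E : ℕ → Set Ω := fun i => exceedSet T m (2 ^ i) (D * ((2 : ℝ) ^ i) ^ α)
  have hE : ∀ i, MeasurableSet (E i) := fun i => h.measurableSet_exceedSet _ _
  have hsub : {ω | ENNReal.ofReal (6 * D * (n : ℝ) ^ (α - 1 / 2))
      < holderNorm α (normalizedPolygonalSum T m n ω)}
      ⊆ ⋃ i : ℕ, ⋃ (_ : 2 ^ i ≤ 2 * n), ⋃ a ∈ Finset.range (n / 2 ^ i + 1),
        T^[a * 2 ^ i] ⁻¹' E i := by
    intro ω hω
    by_contra hcon
    simp only [Set.mem_iUnion, Set.mem_preimage, not_exists, Finset.mem_range] at hcon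
    refine absurd hω (not_lt.mpr
      (holderNorm_normalizedPolygonalSum_le T m hn ω hα0 hα1 fun i hi a ha r hr => ?_))
    by_contra hr'
    exact hcon i hi a (Nat.lt_succ_of_le ((Nat.le_div_iff_mul_le (by positivity)).mpr ha))
      ⟨r, hr, not_le.mp hr'⟩
  refine (measure_mono hsub).trans ((measure_iUnion_le _).trans ?_)
  rw [tailSeries, ← ENNReal.tsum_mul_left]
  refine ENNReal.tsum_le_tsum fun i => ?_
  by_cases hi : 2 ^ i ≤ 2 * n
  · simp only [hi, Set.iUnion_true]
    refine (measure_biUnion_finset_le _ _).trans ?_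
    rw [Finset.sum_congr rfl fun a _ =>
      (h.measurePreserving.iterate (a * 2 ^ i)).measure_preimage (hE i).nullMeasurableSet,
      Finset.sum_const, Finset.card_range, nsmul_eq_mul, ← mul_assoc]
    refine mul_le_mul_left ?_ _
    have hcard : (n / 2 ^ i + 1) * 2 ^ i ≤ 3 * n := by
      rw [add_one_mul]
      have := Nat.div_mul_le_self n (2 ^ i)
      omega
    rw [← ENNReal.inv_pow, ← div_eq_mul_inv,
      ENNReal.le_div_iff_mul_le (Or.inl (by positivity)) (Or.inl (by finiteness))]
    exact_mod_cast hcard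
  · simp [hi]

theorem IsStationaryMDS.weakNormPow_holderNorm_le [IsProbabilityMeasure μ]
    (h : IsStationaryMDS M μ T m) (hm : MemLp m 2 μ) {p : ℝ} (hp : 2 < p) {n : ℕ} (hn : 1 ≤ n) :
    weakNormPow p (fun ω => holderNorm (1 / 2 - 1 / p) (normalizedPolygonalSum T m n ω)) μ
      ≤ 3 * ENNReal.ofReal (6 ^ p) * ENNReal.ofReal (2 ^ (p + 1)) * tailConst p
        * (weakNormPow p (fun ω => ENNReal.ofReal |m ω|) μ + condVarMoment M p μ T m) := by
  refine iSup₂_le fun t ht => ?_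
  have hp0 : 0 < p := by linarith
  have hn0 : (0 : ℝ) < n := by exact_mod_cast hn
  have hip : 1 / p < 1 / 2 := one_div_lt_one_div_of_lt two_pos hp
  have hip0 : 0 < 1 / p := by positivity
  -- the oscillation scale for which the Hölder norm bound is exactly `t`
  set D := t * (n : ℝ) ^ (1 / p) / 6 with hD
  have hD0 : 0 < D := by positivity
  have ht' : 6 * D * (n : ℝ) ^ ((1 / 2 - 1 / p) - 1 / 2) = t := by
    rw [hD, show (1 / 2 - 1 / p) - 1 / 2 = -(1 / p) by ring, Real.rpow_neg hn0.le]
    field_simp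
  have h1 := (h.measure_lt_holderNorm_le (by linarith : 0 ≤ 1 / 2 - 1 / p) (by linarith) hn D).trans
    (mul_le_mul_right (h.tailSeries_le hm hp hD0) _)
  rw [ht'] at h1
  refine (mul_le_mul_right h1 _).trans_eq ?_
  have e : ENNReal.ofReal (t ^ p) * n * ENNReal.ofReal (D ^ (-p)) = ENNReal.ofReal (6 ^ p) := by
    rw [← ENNReal.ofReal_natCast, ← ENNReal.ofReal_mul (by positivity),
      ← ENNReal.ofReal_mul (by positivity)]
    congr 1
    rw [hD, Real.rpow_neg (by positivity), Real.div_rpow (by positivity) (by norm_num),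
      Real.mul_rpow ht.le (by positivity), ← Real.rpow_mul hn0.le, one_div_mul_cancel hp0.ne',
      Real.rpow_one]
    have : 0 < t ^ p := by positivity
    field_simp
  rw [← e]
  ring

end Series

end HolderWIP

theorem proposition2p3 (p : ℝ) (hp : 2 < p) :
    ∃ C : ℝ≥0, ∀ (Ω : Type*) (M : MeasurableSpace Ω) [mΩ : MeasurableSpace Ω] (μ : Measure Ω)
      [IsProbabilityMeasure μ] (T : Ω ≃ᵐ Ω) (m : Ω → ℝ),
      HolderWIP.IsStationaryMDS M μ T m →
        (∀ n : ℕ, 1 ≤ n → ∀ ω : Ω, HolderWIP.MemLittleHolder (1 / 2 - 1 / p)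
          (HolderWIP.normalizedPolygonalSum T m n ω)) ∧
        (⨆ (n : ℕ) (_ : 1 ≤ n), HolderWIP.weakNormPow p
            (fun ω => HolderWIP.holderNorm (1 / 2 - 1 / p)
              (HolderWIP.normalizedPolygonalSum T m n ω)) μ)
          ≤ (C : ℝ≥0∞) * (HolderWIP.weakNormPow p (fun ω => ENNReal.ofReal |m ω|) μ
              + HolderWIP.condVarMoment M p μ T m) := by
  have hC : 3 * ENNReal.ofReal (6 ^ p) * ENNReal.ofReal (2 ^ (p + 1)) * HolderWIP.tailConst p ≠ ∞ :=
    ENNReal.mul_ne_top (by finiteness) (HolderWIP.tailConst_ne_top hp)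
  refine ⟨(3 * ENNReal.ofReal (6 ^ p) * ENNReal.ofReal (2 ^ (p + 1))
    * HolderWIP.tailConst p).toNNReal, fun Ω M mΩ μ _ T m h => ⟨fun n _ ω => ?_, ?_⟩⟩
  · have : 0 < 1 / p := by positivity
    exact HolderWIP.memLittleHolder_normalizedPolygonalSum T m n ω (by linarith)
  · rw [ENNReal.coe_toNNReal hC]
    by_cases hA : HolderWIP.weakNormPow p (fun ω => ENNReal.ofReal |m ω|) μ = ∞
    · -- the constant is positive, so the right-hand side is infinite
      rw [hA, top_add, ENNReal.mul_top]
      · exact le_top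
      · refine mul_ne_zero (mul_ne_zero (mul_ne_zero three_ne_zero ?_) ?_)
          (HolderWIP.tailConst_ne_zero p)
        · simpa using Real.rpow_pos_of_pos (by norm_num : (0 : ℝ) < 6) p
        · simpa using Real.rpow_pos_of_pos two_pos (p + 1)
    · have hm := HolderWIP.memLp_two_of_weakNormPow_ne_top hp (h.measurable.mono h.le le_rfl) hA
      exact iSup₂_le fun n hn => h.weakNormPow_holderNorm_le hm hp hn
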